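/- Work over CompCert's block-based memory model extended with compartments: every allocated block is owned by one compartment, and loading or storing bytes is performed by a compartment and fails if that compartment does not own the block or lacks the (readable, resp. writable) permission. The pointer width (32 or 64 bits) is arbitrary. A *system call semantics* is a relation $\mathit{sem}(ge, C, \overline v, M, t, v, M')$ between a symbol environment $ge$, a calling compartment $C$, arguments $\overline v$, a memory $M$, a trace $t$, a result $v$ and a final memory $M'$. A system call event $\mathtt{Event\_syscall}\ \mathit{name}\ \overline{ev}\ \overline{bs}_{in}\ ev_{res}\ \overline{bs}_{out}$ records the arguments and the result (scalars or pointers to public globals), the bytes $\overline{bs}_{in}$ loaded from global buffers and the bytes $\overline{bs}_{out}$ stored to global buffers. Fix an assignment $\Sigma$ of a semantics to every procedure name. *Matching.* Two traces match in $ge$ (with respect to $\Sigma$) if both are empty, or if both consist of one event and these two events either are equal vstore, annotation, call or return events; or are volatile loads of the same location whose results are valid in $ge$ and have the same type; or are system call events with the same name, arguments and loaded bytes, whose results are valid in $ge$ and have the same type, such that each of the two events is produced by some call to that procedure according to $\Sigma$, in some symbol environment and some initial memory (with arbitrary calling compartment and arguments). *Axiomatization.* A semantics $\mathit{sem}$ satisfies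 the system call axioms for a signature if: (1) results agree with the signature; (2) $\mathit{sem}$ is invariant under equivalence of symbol environments; (3) valid blocks stay valid, their owner does not change, and maximal permissions of valid blocks do not increase; (4) locations without maximal permission Writable are not modified; (5) memory not owned by the calling compartment is unchanged; (6) $\mathit{sem}$ commutes with memory extensions; (7) $\mathit{sem}$ commutes with memory injections that relate the symbols of the two environments and are defined at least on the public symbols of the calling compartment, in both cases with the same trace and without change of locations out of bounds, resp. unmapped or out of reach; (8) at most one event is produced, and it is not a cross-compartment call or return; (9) *weakened receptivity*: if $\mathit{sem}(ge,C,\overline v,M,t_1,v_1,M_1)$ and $t_1$ matches $t_2$, then $\mathit{sem}(ge,C,\overline v,M,t_2,v_2,M_2)$ for some $v_2,M_2$; (10) *weakened determinacy*: if $\mathit{sem}(ge,C,\overline v,M,t_1,v_1,M_1)$ and $\mathit{sem}(ge,C,\overline v,M,t_2,v_2,M_2)$, then $t_1$ matches $t_2$, and $t_1=t_2$ implies $v_1=v_2$ and $M_1=M_2$. *Models.* Both calls take $(\mathit{fd}, \mathit{buf}, n)$, where $\mathit{fd}$ is an int, $\mathit{buf}$ points to a public global and $n$ is a pointer-sized unsigned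 integer, and produce one system call event. $\mathtt{read}$ requires that the calling compartment owns the buffer and that all $n$ bytes from $\mathit{buf}$ on are writable; it stores an arbitrary list of $k \le n$ bytes at $\mathit{buf}$, and the event records no loaded bytes and these $k$ stored bytes. $\mathtt{write}$ requires that the $n$ bytes from $\mathit{buf}$ on can be loaded by the calling compartment and are all concrete bytes; it leaves memory unchanged, and the event records these $n$ loaded bytes and no stored bytes; $k \le n$ is the number of bytes written. In both cases the result is $k$, which must be representable as a nonnegative signed pointer-sized integer, or, if $k=0$, possibly $-1$ (an error). *Theorem.* If $\Sigma$ assigns to a name the model of $\mathtt{read}$, or the model of $\mathtt{write}$, then that semantics satisfies the system call axioms (1)-(10) with respect to $\Sigma$, for the signature $\mathtt{ssize\_t}\,(\mathtt{int},\mathtt{void}{*},\mathtt{size\_t})$. -/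

import Mathlib

/-!
# System calls over CompCert's memory model with compartments

Machine integers are bit vectors; floating-point values are represented by their IEEE 754 bit
patterns.  The pointer width is a parameter, as it is for CompCert's RISC-V target.
-/

namespace Secomp

/-- Target architecture: are pointers 64 bits wide (otherwise 32)? -/
class Archi where
  ptr64 : Bool

/-- Width of a pointer, in bits. -/
def ptrBits [Archi] : ℕ := if Archi.ptr64 then 64 else 32

/-- Pointer offsets (and pointer-sized integers). -/
abbrev Ptrofs [Archi] : Type := BitVec ptrBits

abbrev Byte : Type := BitVec 8
abbrev Block : Type := ℕ
abbrev Ident : Type := ℕ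
abbrev Compartment : Type := ℕ

/-! ## Types, signatures, values -/

inductive Typ where
  | Tint | Tfloat | Tlong | Tsingle | Tany32 | Tany64

/-- The type of pointers and of pointer-sized integers. -/
def Tptr [Archi] : Typ := if Archi.ptr64 then .Tlong else .Tint

inductive Rettype where
  | Tret (t : Typ)
  | Tint8signed | Tint8unsigned | Tint16signed | Tint16unsigned
  | Tvoid

structure Signature where
  sigArgs : List Typ
  sigRes : Rettype

inductive Val [Archi] where
  | Vundef
  | Vint (n : BitVec 32)
  | Vlong (n : BitVec 64)
  | Vfloat (bits : BitVec 64)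
  | Vsingle (bits : BitVec 32)
  | Vptr (b : Block) (ofs : Ptrofs)

/-- A pointer-sized integer, as a value. -/
def Vptrofs [Archi] (n : Ptrofs) : Val :=
  if Archi.ptr64 then .Vlong (n.setWidth 64) else .Vint (n.setWidth 32)

def Val.HasType [Archi] : Val → Typ → Prop
  | .Vundef, _ => True
  | .Vint _, .Tint => True
  | .Vlong _, .Tlong => True
  | .Vfloat _, .Tfloat => True
  | .Vsingle _, .Tsingle => True
  | .Vptr _ _, .Tint => Archi.ptr64 = false
  | .Vptr _ _, .Tlong => Archi.ptr64 = true
  | .Vint _, .Tany32 => True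
  | .Vsingle _, .Tany32 => True
  | .Vptr _ _, .Tany32 => Archi.ptr64 = false
  | _, .Tany64 => True
  | _, _ => False

def Val.HasRettype [Archi] (v : Val) (r : Rettype) : Prop :=
  match r, v with
  | .Tret t, v => v.HasType t
  | .Tint8signed, .Vint n => n = (n.setWidth 8).signExtend 32
  | .Tint8unsigned, .Vint n => n = (n.setWidth 8).setWidth 32
  | .Tint16signed, .Vint n => n = (n.setWidth 16).signExtend 32
  | .Tint16unsigned, .Vint n => n = (n.setWidth 16).setWidth 32
  | _, .Vundef => True
  | _, _ => False

/-- `v₁` is less defined than `v₂`. -/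
inductive Val.Lessdef [Archi] : Val → Val → Prop
  | refl (v : Val) : Lessdef v v
  | undef (v : Val) : Lessdef .Vundef v

/-- Memory injections (as maps on blocks): partial, to blocks with an offset. -/
abbrev Meminj : Type := Block → Option (Block × ℤ)

def injectId : Meminj := fun b => some (b, 0)

inductive Val.Inject [Archi] (f : Meminj) : Val → Val → Prop
  | int (n) : Inject f (.Vint n) (.Vint n)
  | long (n) : Inject f (.Vlong n) (.Vlong n)
  | float (n) : Inject f (.Vfloat n) (.Vfloat n)
  | single (n) : Inject f (.Vsingle n) (.Vsingle n)
  | ptr (b₁ : Block) (ofs₁ : Ptrofs) (b₂ : Block) (ofs₂ : Ptrofs) (delta : ℤ) :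
      f b₁ = some (b₂, delta) → ofs₂ = ofs₁ + BitVec.ofInt ptrBits delta →
      Inject f (.Vptr b₁ ofs₁) (.Vptr b₂ ofs₂)
  | undef (v) : Inject f .Vundef v

def InjectIncr (f f' : Meminj) : Prop :=
  ∀ b b' delta, f b = some (b', delta) → f' b = some (b', delta)

/-! ## Memory -/

inductive MemoryChunk where
  | Mint8signed | Mint8unsigned | Mint16signed | Mint16unsigned | Mint32 | Mint64
  | Mfloat32 | Mfloat64 | Many32 | Many64

def MemoryChunk.size : MemoryChunk → ℤ
  | Mint8signed => 1 | Mint8unsigned => 1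
  | Mint16signed => 2 | Mint16unsigned => 2
  | Mint32 => 4 | Mint64 => 8 | Mfloat32 => 4 | Mfloat64 => 8
  | Many32 => 4 | Many64 => 8

def MemoryChunk.align : MemoryChunk → ℤ
  | Mint8signed => 1 | Mint8unsigned => 1
  | Mint16signed => 2 | Mint16unsigned => 2
  | Mint32 => 4 | Mint64 => 8 | Mfloat32 => 4 | Mfloat64 => 4
  | Many32 => 4 | Many64 => 4

inductive Quantity where
  | Q32 | Q64

/-- Content of one memory cell: undefined, a concrete byte, or the `n`-th fragment of an opaque
value (a pointer, for instance). -/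
inductive Memval [Archi] where
  | Undef
  | Byte (n : Byte)
  | Fragment (v : Val) (q : Quantity) (n : ℕ)

inductive Memval.Inject [Archi] (f : Meminj) : Memval → Memval → Prop
  | byte (n) : Inject f (.Byte n) (.Byte n)
  | frag (v₁ v₂ : Val) (q n) : Val.Inject f v₁ v₂ → Inject f (.Fragment v₁ q n) (.Fragment v₂ q n)
  | undef (mv) : Inject f .Undef mv

inductive Permission where
  | Freeable | Writable | Readable | Nonempty

inductive PermKind where
  | Max | Cur

/-- `PermOrder p q`: permission `p` grants permission `q`. -/
inductive PermOrder : Permission → Permission → Prop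
  | refl (p) : PermOrder p p
  | freeable (p) : PermOrder .Freeable p
  | writable_readable : PermOrder .Writable .Readable
  | any_nonempty (p) : PermOrder p .Nonempty

/-- Memory states: per-byte contents, per-byte permissions, and the compartment that owns each
allocated block. -/
@[ext] structure Mem [Archi] where
  contents : Block → ℤ → Memval
  access : Block → ℤ → PermKind → Option Permission
  owner : Block → Option Compartment
  nextblock : Block
  access_max : ∀ b ofs p, access b ofs .Cur = some p →
    ∃ p', access b ofs .Max = some p' ∧ PermOrder p' p
  nextblock_noaccess : ∀ b ofs k, ¬ b < nextblock → access b ofs k = none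
  contents_default : ∀ b, {ofs | contents b ofs ≠ .Undef}.Finite
  owner_iff : ∀ b, (∃ cp, owner b = some cp) ↔ b < nextblock

namespace Mem

variable [Archi]

def ValidBlock (m : Mem) (b : Block) : Prop := b < m.nextblock

def Perm (m : Mem) (b : Block) (ofs : ℤ) (k : PermKind) (p : Permission) : Prop :=
  ∃ p', m.access b ofs k = some p' ∧ PermOrder p' p

def RangePerm (m : Mem) (b : Block) (lo hi : ℤ) (k : PermKind) (p : Permission) : Prop :=
  ∀ ofs, lo ≤ ofs → ofs < hi → m.Perm b ofs k p

/-- Compartment `cp` owns block `b`. -/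
def CanAccess (m : Mem) (b : Block) (cp : Compartment) : Prop := m.owner b = some cp

/-- The `n` cells from offset `ofs` on. -/
def getN (n : ℕ) (ofs : ℤ) (c : ℤ → Memval) : List Memval :=
  (List.range n).map fun i => c (ofs + i)

/-- Overwrite the cells from offset `ofs` on by the list `vl`. -/
def setN (vl : List Memval) (ofs : ℤ) (c : ℤ → Memval) : ℤ → Memval :=
  fun o => if ofs ≤ o then (vl[(o - ofs).toNat]?).getD (c o) else c o

theorem setN_finite (vl : List Memval) (ofs : ℤ) (c : ℤ → Memval)
    (h : {o | c o ≠ .Undef}.Finite) : {o | setN vl ofs c o ≠ .Undef}.Finite := by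
  refine (h.union (Set.finite_Ico ofs (ofs + vl.length))).subset ?_
  intro o ho
  by_cases h1 : ofs ≤ o ∧ o < ofs + vl.length
  · exact Or.inr h1
  · left
    change setN vl ofs c o ≠ .Undef at ho
    change c o ≠ .Undef
    unfold setN at ho
    split_ifs at ho with h2
    · have : vl.length ≤ (o - ofs).toNat := by omega
      rwa [List.getElem?_eq_none this] at ho
    · exact ho

open Classical in
/-- Compartment `cp` reads `n` bytes; fails if it does not own the block. -/
noncomputable def loadbytes (m : Mem) (b : Block) (ofs : ℤ) (n : ℕ) (cp : Compartment) :
    Option (List Memval) :=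
  if m.RangePerm b ofs (ofs + n) .Cur .Readable ∧ m.CanAccess b cp then
    some (getN n ofs (m.contents b))
  else none

open Classical in
/-- Compartment `cp` writes the bytes `bytes`; fails if it does not own the block. -/
noncomputable def storebytes (m : Mem) (b : Block) (ofs : ℤ) (bytes : List Memval)
    (cp : Compartment) : Option Mem :=
  if m.RangePerm b ofs (ofs + bytes.length) .Cur .Writable ∧ m.CanAccess b cp then
    some
      { m with
        contents := Function.update m.contents b (setN bytes ofs (m.contents b))
        contents_default := by
          intro b'
          by_cases hb : b' = b
          · subst hb
            simpa using setN_finite bytes ofs _ (m.contents_default b')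
          · simpa [Function.update_of_ne hb] using m.contents_default b' }
  else none

/-- `m'` results from `m` without change of the locations in `P` (new blocks may appear). -/
structure UnchangedOn (P : Block → ℤ → Prop) (m m' : Mem) : Prop where
  nextblock : m.nextblock ≤ m'.nextblock
  perm : ∀ b ofs k p, P b ofs → m.ValidBlock b → (m.Perm b ofs k p ↔ m'.Perm b ofs k p)
  contents : ∀ b ofs, P b ofs → m.Perm b ofs .Cur .Readable →
    m'.contents b ofs = m.contents b ofs
  own : ∀ b cp, m.ValidBlock b → (m.CanAccess b cp ↔ m'.CanAccess b cp)

/-- The part common to memory injections and extensions. -/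
structure MemInj (f : Meminj) (m₁ m₂ : Mem) : Prop where
  perm : ∀ b₁ b₂ delta ofs k p, f b₁ = some (b₂, delta) → m₁.Perm b₁ ofs k p →
    m₂.Perm b₂ (ofs + delta) k p
  own : ∀ b₁ b₂ delta cp, f b₁ = some (b₂, delta) → m₁.CanAccess b₁ cp → m₂.CanAccess b₂ cp
  align : ∀ b₁ b₂ delta (chunk : MemoryChunk) ofs p, f b₁ = some (b₂, delta) →
    m₁.RangePerm b₁ ofs (ofs + chunk.size) .Max p → chunk.align ∣ delta
  memval : ∀ b₁ ofs b₂ delta, f b₁ = some (b₂, delta) → m₁.Perm b₁ ofs .Cur .Readable →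
    Memval.Inject f (m₁.contents b₁ ofs) (m₂.contents b₂ (ofs + delta))

def NoOverlap (f : Meminj) (m : Mem) : Prop :=
  ∀ b₁ b₁' delta₁ b₂ b₂' delta₂ ofs₁ ofs₂, b₁ ≠ b₂ →
    f b₁ = some (b₁', delta₁) → f b₂ = some (b₂', delta₂) →
    m.Perm b₁ ofs₁ .Max .Nonempty → m.Perm b₂ ofs₂ .Max .Nonempty →
    b₁' ≠ b₂' ∨ ofs₁ + delta₁ ≠ ofs₂ + delta₂

/-- `f` injects memory `m₁` into memory `m₂`. -/
structure Inject (f : Meminj) (m₁ m₂ : Mem) : Prop where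
  inj : MemInj f m₁ m₂
  freeblocks : ∀ b, ¬ m₁.ValidBlock b → f b = none
  mappedblocks : ∀ b b' delta, f b = some (b', delta) → m₂.ValidBlock b'
  no_overlap : NoOverlap f m₁
  representable : ∀ b b' delta (ofs : Ptrofs), f b = some (b', delta) →
    (m₁.Perm b ofs.toNat .Max .Nonempty ∨ m₁.Perm b ((ofs.toNat : ℤ) - 1) .Max .Nonempty) →
    0 ≤ delta ∧ 0 ≤ (ofs.toNat : ℤ) + delta ∧ (ofs.toNat : ℤ) + delta < 2 ^ ptrBits
  perm_inv : ∀ b₁ ofs b₂ delta k p, f b₁ = some (b₂, delta) → m₂.Perm b₂ (ofs + delta) k p →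
    m₁.Perm b₁ ofs k p ∨ ¬ m₁.Perm b₁ ofs .Max .Nonempty

/-- `m₂` extends `m₁`. -/
structure Extends (m₁ m₂ : Mem) : Prop where
  next : m₁.nextblock = m₂.nextblock
  inj : MemInj injectId m₁ m₂
  perm_inv : ∀ b ofs k p, m₂.Perm b ofs k p →
    m₁.Perm b ofs k p ∨ ¬ m₁.Perm b ofs .Max .Nonempty

end Mem

/-! ## Symbol environments -/

/-- Global symbol environments, with the compartment of each global definition. -/
structure Senv where
  findSymbol : Ident → Option Block
  publicSymbol : Ident → Bool
  blockIsVolatile : Block → Bool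
  findComp : Block → Option Compartment
  nextblock : Block
  findSymbol_injective : ∀ id₁ id₂ b, findSymbol id₁ = some b → findSymbol id₂ = some b → id₁ = id₂
  publicSymbol_exists : ∀ id, publicSymbol id = true → ∃ b, findSymbol id = some b
  findSymbol_below : ∀ id b, findSymbol id = some b → b < nextblock
  blockIsVolatile_below : ∀ b, blockIsVolatile b = true → b < nextblock

structure Senv.Equiv (ge₁ ge₂ : Senv) : Prop where
  findSymbol : ∀ id, ge₂.findSymbol id = ge₁.findSymbol id
  publicSymbol : ∀ id, ge₂.publicSymbol id = ge₁.publicSymbol id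
  blockIsVolatile : ∀ b, ge₂.blockIsVolatile b = ge₁.blockIsVolatile b
  findComp : ∀ b, ge₂.findComp b = ge₁.findComp b

/-- `f` relates the symbols of `ge₁` and `ge₂`; it has to be defined only on the public symbols of
compartment `cp`. -/
structure SymbolsInject (f : Meminj) (ge₁ ge₂ : Senv) (cp : Compartment) : Prop where
  publicSymbol : ∀ id, ge₂.publicSymbol id = ge₁.publicSymbol id
  mapped : ∀ id b₁ b₂ delta, f b₁ = some (b₂, delta) → ge₁.findSymbol id = some b₁ →
    delta = 0 ∧ ge₂.findSymbol id = some b₂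
  defined : ∀ id b₁, ge₁.publicSymbol id = true → ge₁.findSymbol id = some b₁ →
    ge₁.findComp b₁ = some cp → ∃ b₂, f b₁ = some (b₂, 0) ∧ ge₂.findSymbol id = some b₂
  blockIsVolatile : ∀ b₁ b₂ delta, f b₁ = some (b₂, delta) →
    ge₂.blockIsVolatile b₂ = ge₁.blockIsVolatile b₁

/-! ## Events and traces -/

/-- Values in events: scalars and pointers to globals. -/
inductive Eventval [Archi] where
  | EVint (n : BitVec 32)
  | EVlong (n : BitVec 64)
  | EVfloat (bits : BitVec 64)
  | EVsingle (bits : BitVec 32)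
  | EVptrGlobal (id : Ident) (ofs : Ptrofs)

def Eventval.type [Archi] : Eventval → Typ
  | EVint _ => .Tint
  | EVlong _ => .Tlong
  | EVfloat _ => .Tfloat
  | EVsingle _ => .Tsingle
  | EVptrGlobal _ _ => Tptr

def Eventval.Valid [Archi] (ge : Senv) : Eventval → Prop
  | EVptrGlobal id _ => ge.publicSymbol id = true
  | _ => True

/-- `EventvalMatch ge ev ty v`: the event value `ev` records the run-time value `v` of type `ty`. -/
inductive EventvalMatch [Archi] (ge : Senv) : Eventval → Typ → Val → Prop
  | int (n) : EventvalMatch ge (.EVint n) .Tint (.Vint n)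
  | long (n) : EventvalMatch ge (.EVlong n) .Tlong (.Vlong n)
  | float (n) : EventvalMatch ge (.EVfloat n) .Tfloat (.Vfloat n)
  | single (n) : EventvalMatch ge (.EVsingle n) .Tsingle (.Vsingle n)
  | ptr (id : Ident) (b : Block) (ofs : Ptrofs) (ty : Typ) : ty = Tptr →
      ge.publicSymbol id = true → ge.findSymbol id = some b →
      EventvalMatch ge (.EVptrGlobal id ofs) ty (.Vptr b ofs)

inductive EventvalListMatch [Archi] (ge : Senv) : List Eventval → List Typ → List Val → Prop
  | nil : EventvalListMatch ge [] [] []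
  | cons (ev evs ty tys v vs) : EventvalMatch ge ev ty v → EventvalListMatch ge evs tys vs →
      EventvalListMatch ge (ev :: evs) (ty :: tys) (v :: vs)

/-- Observable events.  A system call event records its arguments, the bytes loaded from global
buffers, its result, and the bytes stored to global buffers. -/
inductive Event [Archi] where
  | syscall (name : String) (args : List Eventval) (loaded : List Byte)
      (res : Eventval) (stored : List Byte)
  | vload (chunk : MemoryChunk) (id : Ident) (ofs : Ptrofs) (v : Eventval)
  | vstore (chunk : MemoryChunk) (id : Ident) (ofs : Ptrofs) (v : Eventval)
  | annot (text : String) (args : List Eventval)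
  | call (caller callee : Compartment) (id : Ident) (args : List Eventval)
  | ret (callee caller : Compartment) (v : Eventval)

abbrev Trace [Archi] : Type := List Event

/-! ## System calls and their axiomatization -/

/-- Semantics of a system call: symbol environment, calling compartment, arguments, memory before,
trace, result, memory after. -/
abbrev ExtcallSem [Archi] : Type :=
  Senv → Compartment → List Val → Mem → Trace → Val → Mem → Prop

/-- Some call to the procedure `name`, in some environment and initial memory, produces the given
system call event. -/
def Producible [Archi] (syscalls : String → ExtcallSem) (name : String) (args : List Eventval)
    (loaded : List Byte) (res : Eventval) (stored : List Byte) : Prop :=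
  ∃ ge cp vargs m vres m',
    syscalls name ge cp vargs m [.syscall name args loaded res stored] vres m'

/-- Matching of traces, for the system calls `syscalls`.  Two system call events match if they
agree on procedure, arguments and loaded bytes; the results have to be valid and of the same type,
and result and stored bytes have to be producible by the procedure. -/
inductive MatchTraces [Archi] (syscalls : String → ExtcallSem) (ge : Senv) : Trace → Trace → Prop
  | E0 : MatchTraces syscalls ge [] []
  | syscall (name args loaded res₁ stored₁ res₂ stored₂) :
      res₁.Valid ge → res₂.Valid ge → res₁.type = res₂.type →
      Producible syscalls name args loaded res₁ stored₁ →
      Producible syscalls name args loaded res₂ stored₂ →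
      MatchTraces syscalls ge [.syscall name args loaded res₁ stored₁]
        [.syscall name args loaded res₂ stored₂]
  | vload (chunk id ofs res₁ res₂) :
      res₁.Valid ge → res₂.Valid ge → res₁.type = res₂.type →
      MatchTraces syscalls ge [.vload chunk id ofs res₁] [.vload chunk id ofs res₂]
  | vstore (chunk id ofs arg) :
      MatchTraces syscalls ge [.vstore chunk id ofs arg] [.vstore chunk id ofs arg]
  | annot (text args) : MatchTraces syscalls ge [.annot text args] [.annot text args]
  | call (caller callee id args) :
      MatchTraces syscalls ge [.call caller callee id args] [.call caller callee id args]
  | ret (callee caller v) :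
      MatchTraces syscalls ge [.ret callee caller v] [.ret callee caller v]

def LocOutOfBounds [Archi] (m : Mem) (b : Block) (ofs : ℤ) : Prop := ¬ m.Perm b ofs .Max .Nonempty

def LocUnmapped (f : Meminj) (b : Block) (_ofs : ℤ) : Prop := f b = none

def LocOutOfReach [Archi] (f : Meminj) (m : Mem) (b : Block) (ofs : ℤ) : Prop :=
  ∀ b₀ delta, f b₀ = some (b, delta) → ¬ m.Perm b₀ (ofs - delta) .Max .Nonempty

def LocNotInCompartment [Archi] (cp : Compartment) (m : Mem) (b : Block) (_ofs : ℤ) : Prop :=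
  ¬ m.CanAccess b cp

def InjectSeparated [Archi] (f f' : Meminj) (m₁ m₂ : Mem) : Prop :=
  ∀ b₁ b₂ delta, f b₁ = none → f' b₁ = some (b₂, delta) → ¬ m₁.ValidBlock b₁ ∧ ¬ m₂.ValidBlock b₂

/-- The axiomatization of a system call with semantics `sem` and signature `sg`. -/
structure ExtcallProperties [Archi] (syscalls : String → ExtcallSem) (sem : ExtcallSem)
    (sg : Signature) : Prop where
  /-- The result agrees with the signature. -/
  well_typed : ∀ ge cp vargs m₁ t vres m₂, sem ge cp vargs m₁ t vres m₂ →
    vres.HasRettype sg.sigRes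
  /-- Only the symbols of the environment matter. -/
  symbols_preserved : ∀ ge₁ ge₂ cp vargs m₁ t vres m₂, Senv.Equiv ge₁ ge₂ →
    sem ge₁ cp vargs m₁ t vres m₂ → sem ge₂ cp vargs m₁ t vres m₂
  /-- Memory blocks are not invalidated. -/
  valid_block : ∀ ge cp vargs m₁ t vres m₂ b, sem ge cp vargs m₁ t vres m₂ →
    m₁.ValidBlock b → m₂.ValidBlock b
  /-- Block ownership does not change. -/
  can_access : ∀ ge cp vargs m₁ t vres m₂ b cp', sem ge cp vargs m₁ t vres m₂ →
    m₁.CanAccess b cp' → m₂.CanAccess b cp'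
  /-- Maximal permissions of existing blocks do not increase. -/
  max_perm : ∀ ge cp vargs m₁ t vres m₂ b ofs p, sem ge cp vargs m₁ t vres m₂ →
    m₁.ValidBlock b → m₂.Perm b ofs .Max p → m₁.Perm b ofs .Max p
  /-- Read-only locations are not modified. -/
  readonly : ∀ ge cp vargs m₁ t vres m₂ b ofs n cp' bytes, sem ge cp vargs m₁ t vres m₂ →
    m₁.ValidBlock b → m₂.loadbytes b ofs n cp' = some bytes →
    (∀ i, ofs ≤ i → i < ofs + n → ¬ m₁.Perm b i .Max .Writable) →
    m₁.loadbytes b ofs n cp' = some bytes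
  /-- Only memory of the calling compartment is modified. -/
  outside_compartment : ∀ ge cp vargs m₁ t vres m₂, sem ge cp vargs m₁ t vres m₂ →
    Mem.UnchangedOn (LocNotInCompartment cp m₁) m₁ m₂
  /-- Commutation with memory extensions. -/
  mem_extends : ∀ ge cp vargs m₁ t vres m₂ m₁' vargs', sem ge cp vargs m₁ t vres m₂ →
    Mem.Extends m₁ m₁' → List.Forall₂ Val.Lessdef vargs vargs' →
    ∃ vres' m₂', sem ge cp vargs' m₁' t vres' m₂' ∧ Val.Lessdef vres vres' ∧
      Mem.Extends m₂ m₂' ∧ Mem.UnchangedOn (LocOutOfBounds m₁) m₁' m₂'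
  /-- Commutation with memory injections. -/
  mem_inject : ∀ ge₁ ge₂ cp vargs m₁ t vres m₂ f m₁' vargs', SymbolsInject f ge₁ ge₂ cp →
    sem ge₁ cp vargs m₁ t vres m₂ → Mem.Inject f m₁ m₁' →
    List.Forall₂ (Val.Inject f) vargs vargs' →
    ∃ f' vres' m₂', sem ge₂ cp vargs' m₁' t vres' m₂' ∧ Val.Inject f' vres vres' ∧
      Mem.Inject f' m₂ m₂' ∧ Mem.UnchangedOn (LocUnmapped f) m₁ m₂ ∧
      Mem.UnchangedOn (LocOutOfReach f m₁) m₁' m₂' ∧ InjectIncr f f' ∧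
      InjectSeparated f f' m₁ m₁'
  /-- At most one event is produced. -/
  trace_length : ∀ ge cp vargs m t vres m', sem ge cp vargs m t vres m' → t.length ≤ 1
  /-- No cross-compartment call or return is produced. -/
  no_crossing : ∀ ge cp vargs m t vres m' e, sem ge cp vargs m t vres m' → e ∈ t →
    (∀ caller callee id args, e ≠ .call caller callee id args) ∧
    (∀ callee caller v, e ≠ .ret callee caller v)
  /-- Receptivity: every matching trace is possible as well. -/
  receptive : ∀ ge cp vargs m t₁ vres₁ m₁ t₂, sem ge cp vargs m t₁ vres₁ m₁ →
    MatchTraces syscalls ge t₁ t₂ → ∃ vres₂ m₂, sem ge cp vargs m t₂ vres₂ m₂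
  /-- Determinacy: traces match, and the trace determines result and final memory. -/
  determ : ∀ ge cp vargs m t₁ vres₁ m₁ t₂ vres₂ m₂, sem ge cp vargs m t₁ vres₁ m₁ →
    sem ge cp vargs m t₂ vres₂ m₂ →
    MatchTraces syscalls ge t₁ t₂ ∧ (t₁ = t₂ → vres₁ = vres₂ ∧ m₁ = m₂)

/-! ## Models of `read` and `write` -/

/-- Signature `ssize_t (int fd, void *buf, size_t count)`. -/
def ioSig [Archi] : Signature := ⟨[.Tint, Tptr, Tptr], .Tret Tptr⟩

/-- Possible results of a transfer of `k` bytes: the count, which `ssize_t` must be able to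
represent, or, when nothing was transferred, the error code `-1`. -/
inductive TransferResult [Archi] : ℕ → Val → Prop
  | count (k : ℕ) : k < 2 ^ (ptrBits - 1) → TransferResult k (Vptrofs (BitVec.ofNat ptrBits k))
  | error : TransferResult 0 (Vptrofs (-1))

/-- `read(fd, buf, count)`: `buf` must be writable for `count` bytes by the calling compartment;
at most `count` arbitrary bytes are stored into it. -/
inductive readSem [Archi] (name : String) : ExtcallSem
  | intro (ge : Senv) (cp : Compartment) (fd : BitVec 32) (b : Block) (ofs count : Ptrofs)
      (m : Mem) (args : List Eventval) (res : Eventval) (stored : List Byte) (vres : Val)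
      (m' : Mem) :
      EventvalListMatch ge args ioSig.sigArgs [.Vint fd, .Vptr b ofs, Vptrofs count] →
      m.RangePerm b ofs.toNat (ofs.toNat + count.toNat) .Cur .Writable →
      stored.length ≤ count.toNat →
      m.storebytes b ofs.toNat (stored.map .Byte) cp = some m' →
      TransferResult stored.length vres →
      EventvalMatch ge res Tptr vres →
      readSem name ge cp [.Vint fd, .Vptr b ofs, Vptrofs count] m
        [.syscall name args [] res stored] vres m'

/-- `write(fd, buf, count)`: `buf` must hold `count` concrete bytes readable by the calling
compartment; at most `count` of them are written, and memory does not change. -/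
inductive writeSem [Archi] (name : String) : ExtcallSem
  | intro (ge : Senv) (cp : Compartment) (fd : BitVec 32) (b : Block) (ofs count : Ptrofs)
      (m : Mem) (args : List Eventval) (res : Eventval) (loaded : List Byte) (k : ℕ)
      (vres : Val) :
      EventvalListMatch ge args ioSig.sigArgs [.Vint fd, .Vptr b ofs, Vptrofs count] →
      m.loadbytes b ofs.toNat count.toNat cp = some (loaded.map .Byte) →
      k ≤ count.toNat →
      TransferResult k vres →
      EventvalMatch ge res Tptr vres →
      writeSem name ge cp [.Vint fd, .Vptr b ofs, Vptrofs count] m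
        [.syscall name args loaded res []] vres m

end Secomp

/-!
Both models act on a buffer `b` that is a public global, and an event determines everything the
models depend on except the memory: it records the descriptor, the *name* of the buffer, the offset
and the count, and `eventvalListMatch_io_iff` recovers the arguments from it.  `readSem_iff` and
`writeSem_iff` put the two relations into this form.

* Receptivity.  A matching event is producible by the same model, in an unrelated environment and
  memory.  As the events share their arguments, the unrelated call has the same count, so its
  result and its number of bytes are within the bounds of the present call as well.  For `read`,
  all `count` bytes of the buffer are writable, not only the bytes stored by the first call, so
  that the other bytes can be stored too.
* Determinacy.  Symbol lookup is injective, hence the name of the buffer is determined by the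
  block; the bytes loaded by `write` are determined by the memory.  Results are pointer-sized
  integers, which are valid event values in every environment.
* Injections and extensions.  The buffer has a symbol, hence an injection relating the symbols maps
  it with offset zero to the block of the same symbol, and the same event is produced.
  Concrete bytes inject only into themselves, so `write` loads the same bytes.  For `read`,
  `Mem.MemInj.storebytes` shows that parallel stores preserve injections: by absence of overlap, no
  other accessible location is mapped into the bytes written.
* The remaining axioms follow from `Mem.storebytes_unchangedOn`: `read` changes no location but
  the bytes stored, which are writable and owned by the calling compartment.
-/

namespace Secomp

/-! ### Pointer-sized integers as values and as event values -/

/-- A pointer-sized integer, as an event value; the counterpart of `Vptrofs`. -/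
def EVptrofs [Archi] (n : Ptrofs) : Eventval :=
  if Archi.ptr64 then .EVlong (n.setWidth 64) else .EVint (n.setWidth 32)

section Values

variable [Archi]

theorem Vptrofs_injective : Function.Injective Vptrofs := by
  intro n n' h
  apply BitVec.eq_of_toNat_eq
  unfold Vptrofs at h
  split_ifs at h with hp
  · have hb : 2 ^ ptrBits = 2 ^ 64 := by simp [ptrBits, hp]
    have hn := n.isLt.trans_eq hb
    have hn' := n'.isLt.trans_eq hb
    have h1 := congrArg BitVec.toNat (Val.Vlong.inj h)
    rwa [BitVec.toNat_setWidth, BitVec.toNat_setWidth, Nat.mod_eq_of_lt hn,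
      Nat.mod_eq_of_lt hn'] at h1
  · have hb : 2 ^ ptrBits = 2 ^ 32 := by simp [ptrBits, hp]
    have hn := n.isLt.trans_eq hb
    have hn' := n'.isLt.trans_eq hb
    have h1 := congrArg BitVec.toNat (Val.Vint.inj h)
    rwa [BitVec.toNat_setWidth, BitVec.toNat_setWidth, Nat.mod_eq_of_lt hn,
      Nat.mod_eq_of_lt hn'] at h1

theorem Vptrofs_hasType (n : Ptrofs) : (Vptrofs n).HasType Tptr := by
  unfold Vptrofs Tptr
  split_ifs <;> trivial

theorem EVptrofs_valid (ge : Senv) (n : Ptrofs) : (EVptrofs n).Valid ge := by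
  unfold EVptrofs
  split_ifs <;> trivial

theorem EVptrofs_type (n : Ptrofs) : (EVptrofs n).type = Tptr := by
  unfold EVptrofs Tptr
  split_ifs <;> rfl

theorem eventvalMatch_Vptrofs_iff {ge : Senv} {ev : Eventval} {n : Ptrofs} :
    EventvalMatch ge ev Tptr (Vptrofs n) ↔ ev = EVptrofs n := by
  unfold Vptrofs Tptr EVptrofs
  split_ifs
  · constructor
    · rintro ⟨⟩
      rfl
    · rintro rfl
      exact .long _
  · constructor
    · rintro ⟨⟩
      rfl
    · rintro rfl
      exact .int _

theorem EVptrofs_injective : Function.Injective EVptrofs := by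
  intro n n' h
  apply Vptrofs_injective
  unfold EVptrofs at h
  unfold Vptrofs
  split_ifs at h ⊢
  · rw [Eventval.EVlong.inj h]
  · rw [Eventval.EVint.inj h]

theorem EventvalMatch.exists_of_Vptr {ge : Senv} {ev : Eventval} {ty : Typ} {b : Block}
    {ofs : Ptrofs} (h : EventvalMatch ge ev ty (.Vptr b ofs)) :
    ∃ id, ge.publicSymbol id = true ∧ ge.findSymbol id = some b ∧ ev = .EVptrGlobal id ofs := by
  cases h
  exact ⟨_, ‹_›, ‹_›, rfl⟩

theorem eventvalListMatch_io_iff {ge : Senv} {args : List Eventval} {fd : BitVec 32} {b : Block}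
    {ofs count : Ptrofs} :
    EventvalListMatch ge args ioSig.sigArgs [.Vint fd, .Vptr b ofs, Vptrofs count] ↔
      ∃ id, ge.publicSymbol id = true ∧ ge.findSymbol id = some b ∧
        args = [.EVint fd, .EVptrGlobal id ofs, EVptrofs count] := by
  constructor
  · rintro ⟨⟩
    rename_i h1 h2
    obtain ⟨⟩ := h2
    rename_i h2 h3
    obtain ⟨⟩ := h3
    rename_i h3 h4
    obtain ⟨⟩ := h4
    obtain rfl := eventvalMatch_Vptrofs_iff.1 h3
    cases h1
    obtain ⟨id, hp, hs, rfl⟩ := h2.exists_of_Vptr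
    exact ⟨id, hp, hs, rfl⟩
  · rintro ⟨id, hp, hs, rfl⟩
    exact .cons _ _ _ _ _ _ (.int fd) (.cons _ _ _ _ _ _ (.ptr id b ofs _ rfl hp hs)
      (.cons _ _ _ _ _ _ (eventvalMatch_Vptrofs_iff.2 rfl) .nil))

theorem TransferResult.exists_eq_Vptrofs {k : ℕ} {v : Val} (h : TransferResult k v) :
    ∃ r, v = Vptrofs r := by
  cases h <;> exact ⟨_, rfl⟩

theorem Vptrofs_inject (f : Meminj) (n : Ptrofs) : Val.Inject f (Vptrofs n) (Vptrofs n) := by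
  unfold Vptrofs
  split_ifs
  · exact .long _
  · exact .int _

theorem Val.Inject.eq_of_Vptrofs {f : Meminj} {n : Ptrofs} {v : Val}
    (h : Val.Inject f (Vptrofs n) v) : v = Vptrofs n := by
  unfold Vptrofs at h ⊢
  split_ifs at h ⊢ <;> (cases h; rfl)

theorem Val.Lessdef.eq_of_Vptrofs {n : Ptrofs} {v : Val} (h : Val.Lessdef (Vptrofs n) v) :
    v = Vptrofs n := by
  unfold Vptrofs at h ⊢
  split_ifs at h ⊢ <;> (cases h; rfl)

theorem forall₂_lessdef_io {fd : BitVec 32} {b : Block} {ofs count : Ptrofs} {vs : List Val}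
    (h : List.Forall₂ Val.Lessdef [.Vint fd, .Vptr b ofs, Vptrofs count] vs) :
    vs = [.Vint fd, .Vptr b ofs, Vptrofs count] := by
  obtain ⟨⟩ := h
  rename_i h1 h
  obtain ⟨⟩ := h
  rename_i h2 h
  obtain ⟨⟩ := h
  rename_i h3 h
  obtain ⟨⟩ := h
  cases h1
  cases h2
  rw [h3.eq_of_Vptrofs]

theorem forall₂_inject_io {f : Meminj} {fd : BitVec 32} {b : Block} {ofs count : Ptrofs}
    {vs : List Val}
    (h : List.Forall₂ (Val.Inject f) [.Vint fd, .Vptr b ofs, Vptrofs count] vs) :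
    ∃ b' delta, f b = some (b', delta) ∧
      vs = [.Vint fd, .Vptr b' (ofs + BitVec.ofInt ptrBits delta), Vptrofs count] := by
  obtain ⟨⟩ := h
  rename_i h1 h
  obtain ⟨⟩ := h
  rename_i h2 h
  obtain ⟨⟩ := h
  rename_i h3 h
  obtain ⟨⟩ := h
  cases h1
  cases h2 with
  | ptr _ _ b' _ delta hf ho =>
    subst ho
    exact ⟨b', delta, hf, by rw [h3.eq_of_Vptrofs]⟩

/-- A block that has a symbol is mapped to the block of that symbol, at the same offset. -/
theorem forall₂_inject_io_symbol {f : Meminj} {ge₁ ge₂ : Senv} {cp : Compartment} {id : Ident}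
    {fd : BitVec 32} {b : Block} {ofs count : Ptrofs} {vs : List Val}
    (hsym : SymbolsInject f ge₁ ge₂ cp) (hid : ge₁.findSymbol id = some b)
    (h : List.Forall₂ (Val.Inject f) [.Vint fd, .Vptr b ofs, Vptrofs count] vs) :
    ∃ b', f b = some (b', 0) ∧ ge₂.findSymbol id = some b' ∧
      vs = [.Vint fd, .Vptr b' ofs, Vptrofs count] := by
  obtain ⟨b', delta, hf, rfl⟩ := forall₂_inject_io h
  obtain ⟨rfl, hid'⟩ := hsym.mapped id b b' delta hf hid
  refine ⟨b', hf, hid', ?_⟩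
  rw [BitVec.ofInt_ofNat, BitVec.add_zero]

end Values

/-! ### Permissions, loads and stores -/

theorem PermOrder.trans {p q r : Permission} (h₁ : PermOrder p q) (h₂ : PermOrder q r) :
    PermOrder p r := by
  cases h₁ <;> cases h₂ <;> constructor

namespace Mem

variable [Archi] {m m' m₁ m₂ m₁' m₂' : Mem} {b : Block} {ofs : ℤ} {cp : Compartment}

theorem Perm.mono {k : PermKind} {p q : Permission} (h : m.Perm b ofs k p) (hpq : PermOrder p q) :
    m.Perm b ofs k q := by
  obtain ⟨p', h₁, h₂⟩ := h
  exact ⟨p', h₁, h₂.trans hpq⟩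

theorem Perm.max {p : Permission} (h : m.Perm b ofs .Cur p) : m.Perm b ofs .Max p := by
  obtain ⟨p', h₁, h₂⟩ := h
  obtain ⟨p'', h₃, h₄⟩ := m.access_max b ofs p' h₁
  exact ⟨p'', h₃, h₄.trans h₂⟩

theorem Perm.max_nonempty {p : Permission} (h : m.Perm b ofs .Cur p) :
    m.Perm b ofs .Max .Nonempty :=
  h.max.mono (.any_nonempty p)

theorem UnchangedOn.refl (P : Block → ℤ → Prop) (m : Mem) : UnchangedOn P m m :=
  ⟨le_rfl, fun _ _ _ _ _ _ => Iff.rfl, fun _ _ _ _ => rfl, fun _ _ _ => Iff.rfl⟩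

theorem setN_of_notMem {vl : List Memval} {c : ℤ → Memval} {o : ℤ}
    (h : ¬ (ofs ≤ o ∧ o < ofs + vl.length)) : setN vl ofs c o = c o := by
  unfold setN
  split_ifs with h1
  · rw [List.getElem?_eq_none (by omega), Option.getD_none]
  · rfl

theorem setN_add {vl : List Memval} {c : ℤ → Memval} {i : ℕ} (h : i < vl.length) :
    setN vl ofs c (ofs + i) = vl[i] := by
  unfold setN
  rw [if_pos (by omega), add_sub_cancel_left, Int.toNat_natCast, List.getElem?_eq_getElem h,
    Option.getD_some]

/-- In the definition of `getN` it is the list of positions, not the position `i`, that is coerced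
to the integers; this is the form with the coercion inside. -/
theorem getN_eq_map (n : ℕ) (ofs : ℤ) (c : ℤ → Memval) :
    getN n ofs c = (List.range n).map fun i : ℕ => c (ofs + i) := by
  simp [getN, ← List.map_eq_flatMap]

theorem loadbytes_eq_some_iff {n : ℕ} {bytes : List Memval} :
    m.loadbytes b ofs n cp = some bytes ↔
      m.RangePerm b ofs (ofs + n) .Cur .Readable ∧ m.CanAccess b cp ∧
        bytes = getN n ofs (m.contents b) := by
  unfold loadbytes
  split_ifs with h
  · simp [h.1, h.2, eq_comm]
  · simp only [false_iff]
    exact fun h' => h ⟨h'.1, h'.2.1⟩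

theorem storebytes_eq_some_iff {bytes : List Memval} :
    m.storebytes b ofs bytes cp = some m' ↔
      m.RangePerm b ofs (ofs + bytes.length) .Cur .Writable ∧ m.CanAccess b cp ∧
        m'.contents = Function.update m.contents b (setN bytes ofs (m.contents b)) ∧
        m'.access = m.access ∧ m'.owner = m.owner ∧ m'.nextblock = m.nextblock := by
  unfold storebytes
  split_ifs with h
  · rw [Option.some.injEq]
    constructor
    · rintro rfl
      exact ⟨h.1, h.2, rfl, rfl, rfl, rfl⟩
    · rintro ⟨-, -, h1, h2, h3, h4⟩
      exact Mem.ext h1.symm h2.symm h3.symm h4.symm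
  · simp only [false_iff]
    exact fun h' => h ⟨h'.1, h'.2.1⟩

theorem exists_storebytes {bytes : List Memval}
    (h : m.RangePerm b ofs (ofs + bytes.length) .Cur .Writable) (hcp : m.CanAccess b cp) :
    ∃ m', m.storebytes b ofs bytes cp = some m' := by
  unfold storebytes
  rw [if_pos ⟨h, hcp⟩]
  exact ⟨_, rfl⟩

section Store

variable {bytes : List Memval}

theorem perm_storebytes (h : m.storebytes b ofs bytes cp = some m') : m'.Perm = m.Perm := by
  obtain ⟨-, -, -, h, -, -⟩ := storebytes_eq_some_iff.1 h
  unfold Perm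
  rw [h]

theorem canAccess_storebytes (h : m.storebytes b ofs bytes cp = some m') :
    m'.CanAccess = m.CanAccess := by
  obtain ⟨-, -, -, -, h, -⟩ := storebytes_eq_some_iff.1 h
  unfold CanAccess
  rw [h]

theorem validBlock_storebytes (h : m.storebytes b ofs bytes cp = some m') :
    m'.ValidBlock = m.ValidBlock := by
  obtain ⟨-, -, -, -, -, h⟩ := storebytes_eq_some_iff.1 h
  unfold ValidBlock
  rw [h]

theorem contents_storebytes_of_notMem (h : m.storebytes b ofs bytes cp = some m') {b' : Block}
    {o : ℤ} (hn : ¬ (b' = b ∧ ofs ≤ o ∧ o < ofs + bytes.length)) :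
    m'.contents b' o = m.contents b' o := by
  obtain ⟨-, -, h, -, -, -⟩ := storebytes_eq_some_iff.1 h
  rw [h]
  by_cases hb : b' = b
  · subst hb
    rw [Function.update_self, setN_of_notMem fun h' => hn ⟨rfl, h'⟩]
  · rw [Function.update_of_ne hb]

theorem contents_storebytes_add (h : m.storebytes b ofs bytes cp = some m') {i : ℕ}
    (hi : i < bytes.length) : m'.contents b (ofs + i) = bytes[i] := by
  obtain ⟨-, -, h, -, -, -⟩ := storebytes_eq_some_iff.1 h
  rw [h, Function.update_self, setN_add hi]

theorem storebytes_unchangedOn (h : m.storebytes b ofs bytes cp = some m')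
    {P : Block → ℤ → Prop} (hP : ∀ o, ofs ≤ o → o < ofs + bytes.length → ¬ P b o) :
    UnchangedOn P m m' where
  nextblock := (storebytes_eq_some_iff.1 h).2.2.2.2.2.ge
  perm _ _ _ _ _ _ := by rw [perm_storebytes h]
  contents b' o hp _ := by
    refine contents_storebytes_of_notMem h ?_
    rintro ⟨rfl, h1, h2⟩
    exact hP o h1 h2 hp
  own _ _ _ := by rw [canAccess_storebytes h]

end Store

theorem loadbytes_of_readonly {bytes bs : List Memval} {b' : Block} {o : ℤ} {n : ℕ}
    {cp' : Compartment} (h : m.storebytes b ofs bytes cp = some m')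
    (hl : m'.loadbytes b' o n cp' = some bs)
    (hw : ∀ i, o ≤ i → i < o + n → ¬ m.Perm b' i .Max .Writable) :
    m.loadbytes b' o n cp' = some bs := by
  obtain ⟨h1, h2, rfl⟩ := loadbytes_eq_some_iff.1 hl
  rw [canAccess_storebytes h] at h2
  unfold RangePerm at h1
  rw [perm_storebytes h] at h1
  refine loadbytes_eq_some_iff.2 ⟨h1, h2, ?_⟩
  rw [getN_eq_map, getN_eq_map]
  refine List.map_congr_left fun i hi => contents_storebytes_of_notMem h ?_
  rintro ⟨rfl, h3, h4⟩
  have hi := List.mem_range.1 hi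
  exact hw _ (by omega) (by omega) ((storebytes_eq_some_iff.1 h).1 _ h3 h4).max

/-! ### Loads and stores under injections and extensions -/

section Injection

variable {f : Meminj} {b₁ b₂ : Block} {delta : ℤ}

theorem MemInj.rangePerm (hinj : MemInj f m₁ m₂) (hf : f b₁ = some (b₂, delta)) {lo hi : ℤ}
    {k : PermKind} {p : Permission} (h : m₁.RangePerm b₁ lo hi k p) :
    m₂.RangePerm b₂ (lo + delta) (hi + delta) k p := by
  intro o h1 h2
  have := hinj.perm b₁ b₂ delta (o - delta) k p hf (h _ (by omega) (by omega))
  rwa [sub_add_cancel] at this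

/-- Concrete bytes inject only into themselves, so that loading them commutes with injections. -/
theorem MemInj.loadbytes (hinj : MemInj f m₁ m₂) (hf : f b₁ = some (b₂, delta)) {n : ℕ}
    {bytes : List Byte} (h : m₁.loadbytes b₁ ofs n cp = some (bytes.map .Byte)) :
    m₂.loadbytes b₂ (ofs + delta) n cp = some (bytes.map .Byte) := by
  obtain ⟨h1, h2, h3⟩ := loadbytes_eq_some_iff.1 h
  have h4 := hinj.rangePerm hf h1
  rw [add_right_comm] at h4
  refine loadbytes_eq_some_iff.2 ⟨h4, hinj.own _ _ _ _ hf h2, ?_⟩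
  rw [h3, getN_eq_map, getN_eq_map]
  refine List.map_congr_left fun i hi => ?_
  have hi := List.mem_range.1 hi
  have h5 := hinj.memval b₁ (ofs + i) b₂ delta hf (h1 _ (by omega) (by omega))
  have h6 : m₁.contents b₁ (ofs + i) ∈ bytes.map Memval.Byte := by
    rw [h3, getN_eq_map]
    exact List.mem_map.2 ⟨i, List.mem_range.2 hi, rfl⟩
  obtain ⟨x, -, hx⟩ := List.mem_map.1 h6
  rw [← hx] at h5 ⊢
  rw [add_right_comm]
  generalize m₂.contents b₂ (ofs + i + delta) = y at h5
  cases h5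
  rfl

theorem MemInj.exists_storebytes (hinj : MemInj f m₁ m₂) (hf : f b₁ = some (b₂, delta))
    {bytes : List Memval} (h : m₁.storebytes b₁ ofs bytes cp = some m₁') :
    ∃ m₂', m₂.storebytes b₂ (ofs + delta) bytes cp = some m₂' := by
  obtain ⟨h1, h2, -⟩ := storebytes_eq_some_iff.1 h
  have h3 := hinj.rangePerm hf h1
  rw [add_right_comm] at h3
  exact Mem.exists_storebytes h3 (hinj.own _ _ _ _ hf h2)

/-- Storing the same bytes on both sides preserves an injection, provided that these bytes inject
into themselves and that `f` does not make accessible locations overlap. -/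
theorem MemInj.storebytes (hinj : MemInj f m₁ m₂) (hno : NoOverlap f m₁)
    (hf : f b₁ = some (b₂, delta)) {bytes : List Memval}
    (hb : ∀ v ∈ bytes, Memval.Inject f v v)
    (h₁ : m₁.storebytes b₁ ofs bytes cp = some m₁')
    (h₂ : m₂.storebytes b₂ (ofs + delta) bytes cp = some m₂') : MemInj f m₁' m₂' where
  perm := by
    rw [perm_storebytes h₁, perm_storebytes h₂]
    exact hinj.perm
  own := by
    rw [canAccess_storebytes h₁, canAccess_storebytes h₂]
    exact hinj.own
  align := by
    unfold RangePerm
    rw [perm_storebytes h₁]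
    exact hinj.align
  memval b o b' d hf' hp := by
    rw [perm_storebytes h₁] at hp
    by_cases hin : b = b₁ ∧ ofs ≤ o ∧ o < ofs + bytes.length
    · obtain ⟨rfl, h3, h4⟩ := hin
      obtain ⟨rfl, rfl⟩ : b₂ = b' ∧ delta = d := by
        rw [hf] at hf'
        simpa using hf'
      obtain ⟨i, rfl⟩ : ∃ i : ℕ, o = ofs + i := ⟨(o - ofs).toNat, by omega⟩
      have hi : i < bytes.length := by omega
      rw [add_right_comm, contents_storebytes_add h₁ hi, contents_storebytes_add h₂ hi]
      exact hb _ (List.getElem_mem hi)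
    · rw [contents_storebytes_of_notMem h₁ hin, contents_storebytes_of_notMem h₂ ?_]
      · exact hinj.memval b o b' d hf' hp
      · rintro ⟨rfl, h3, h4⟩
        by_cases hbb : b = b₁
        · subst hbb
          obtain rfl : delta = d := by
            rw [hf] at hf'
            simpa using hf'
          exact hin ⟨rfl, by omega, by omega⟩
        · -- The byte written at `o + d` is the image of the writable offset `o + d - delta` of
          -- `b₁`; the readable location `(b, o)` cannot have the same image.
          have hw := (storebytes_eq_some_iff.1 h₁).1 (o + d - delta) (by omega) (by omega)
          rcases hno b b' d b₁ b' delta o _ hbb hf' hf hp.max_nonempty hw.max_nonempty with h | h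
          · exact h rfl
          · omega

theorem noOverlap_injectId (m : Mem) : NoOverlap injectId m := by
  intro b₁ b₁' d₁ b₂ b₂' d₂ o₁ o₂ hne h1 h2 _ _
  simp only [injectId, Option.some.injEq, Prod.mk.injEq] at h1 h2
  left
  rw [← h1.1, ← h2.1]
  exact hne

theorem Inject.storebytes (hinj : Mem.Inject f m₁ m₂)
    (hf : f b₁ = some (b₂, delta)) {bytes : List Memval}
    (hb : ∀ v ∈ bytes, Memval.Inject f v v)
    (h₁ : m₁.storebytes b₁ ofs bytes cp = some m₁')
    (h₂ : m₂.storebytes b₂ (ofs + delta) bytes cp = some m₂') : Mem.Inject f m₁' m₂' where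
  inj := hinj.inj.storebytes hinj.no_overlap hf hb h₁ h₂
  freeblocks := by
    rw [validBlock_storebytes h₁]
    exact hinj.freeblocks
  mappedblocks := by
    rw [validBlock_storebytes h₂]
    exact hinj.mappedblocks
  no_overlap := by
    unfold NoOverlap
    rw [perm_storebytes h₁]
    exact hinj.no_overlap
  representable := by
    rw [perm_storebytes h₁]
    exact hinj.representable
  perm_inv := by
    rw [perm_storebytes h₁, perm_storebytes h₂]
    exact hinj.perm_inv

theorem Extends.storebytes (hext : Mem.Extends m₁ m₂) {bytes : List Memval}
    (hb : ∀ v ∈ bytes, Memval.Inject injectId v v)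
    (h₁ : m₁.storebytes b ofs bytes cp = some m₁')
    (h₂ : m₂.storebytes b ofs bytes cp = some m₂') : Mem.Extends m₁' m₂' where
  next := by
    rw [(storebytes_eq_some_iff.1 h₁).2.2.2.2.2, (storebytes_eq_some_iff.1 h₂).2.2.2.2.2]
    exact hext.next
  inj := hext.inj.storebytes (noOverlap_injectId m₁) (rfl : injectId b = some (b, 0)) hb h₁
    (by rwa [add_zero])
  perm_inv := by
    rw [perm_storebytes h₁, perm_storebytes h₂]
    exact hext.perm_inv

end Injection

theorem inject_of_mem_map_byte (f : Meminj) (bytes : List Byte) :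
    ∀ v ∈ bytes.map Memval.Byte, Memval.Inject f v v := by
  intro v hv
  obtain ⟨x, -, rfl⟩ := List.mem_map.1 hv
  exact .byte x

end Mem

/-! ### The model of `read` -/

section Read

variable [Archi] {name : String} {ge : Senv} {cp : Compartment} {vargs : List Val} {m m' : Mem}
  {t : Trace} {vres : Val}

theorem readSem_iff : readSem name ge cp vargs m t vres m' ↔
    ∃ fd b ofs count id stored r,
      vargs = [.Vint fd, .Vptr b ofs, Vptrofs count] ∧
      t = [.syscall name [.EVint fd, .EVptrGlobal id ofs, EVptrofs count] [] (EVptrofs r) stored] ∧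
      vres = Vptrofs r ∧ ge.publicSymbol id = true ∧ ge.findSymbol id = some b ∧
      m.RangePerm b ofs.toNat (ofs.toNat + count.toNat) .Cur .Writable ∧
      stored.length ≤ count.toNat ∧
      m.storebytes b ofs.toNat (stored.map .Byte) cp = some m' ∧
      TransferResult stored.length (Vptrofs r) := by
  constructor
  · rintro ⟨_, _, fd, b, ofs, count, _, args, res, stored, _, _, h1, h2, h3, h4, h5, h6⟩
    obtain ⟨r, rfl⟩ := h5.exists_eq_Vptrofs
    obtain rfl := eventvalMatch_Vptrofs_iff.1 h6
    obtain ⟨id, hp, hs, rfl⟩ := eventvalListMatch_io_iff.1 h1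
    exact ⟨fd, b, ofs, count, id, stored, r, rfl, rfl, rfl, hp, hs, h2, h3, h4, h5⟩
  · rintro ⟨fd, b, ofs, count, id, stored, r, rfl, rfl, rfl, hp, hs, h2, h3, h4, h5⟩
    exact .intro ge cp fd b ofs count m _ _ stored _ m'
      (eventvalListMatch_io_iff.2 ⟨id, hp, hs, rfl⟩) h2 h3 h4 h5 (eventvalMatch_Vptrofs_iff.2 rfl)

theorem exists_storebytes_of_readSem (h : readSem name ge cp vargs m t vres m') :
    ∃ b ofs bytes, m.storebytes b ofs bytes cp = some m' := by
  obtain ⟨-, b, ofs, -, -, stored, -, -, -, -, -, -, -, -, h, -⟩ := readSem_iff.1 h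
  exact ⟨b, _, _, h⟩

theorem readSem_receptive {syscalls : String → ExtcallSem} (hname : syscalls name = readSem name)
    {t' : Trace} (h : readSem name ge cp vargs m t vres m') (ht : MatchTraces syscalls ge t t') :
    ∃ vres₂ m₂, readSem name ge cp vargs m t' vres₂ m₂ := by
  obtain ⟨fd, b, ofs, count, id, stored, r, rfl, rfl, rfl, hp, hs, hw, -, hst, -⟩ :=
    readSem_iff.1 h
  cases ht with
  | syscall _ _ _ _ _ res₂ stored₂ _ _ _ _ hprod =>
    obtain ⟨ge', cp', vargs', m₀, v', m₀', hsem⟩ := hprod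
    rw [hname] at hsem
    obtain ⟨fd', b', ofs', count', id', stored', r', -, heq, -, -, -, -, hlen, -, htr⟩ :=
      readSem_iff.1 hsem
    simp only [List.cons.injEq, Event.syscall.injEq, true_and, and_true] at heq
    obtain ⟨⟨-, -, hcount⟩, rfl, rfl⟩ := heq
    obtain rfl := EVptrofs_injective hcount
    obtain ⟨m₂, hm₂⟩ := Mem.exists_storebytes (m := m) (b := b) (ofs := ofs.toNat)
      (bytes := stored₂.map .Byte) (cp := cp)
      (fun o h1 h2 => hw o h1 (by rw [List.length_map] at h2; omega))
      (Mem.storebytes_eq_some_iff.1 hst).2.1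
    exact ⟨Vptrofs r', m₂, readSem_iff.2 ⟨fd, b, ofs, count, id, stored₂, r', rfl, rfl, rfl, hp, hs,
      hw, hlen, hm₂, htr⟩⟩

theorem readSem_determ {syscalls : String → ExtcallSem} (hname : syscalls name = readSem name)
    {t' : Trace} {vres₂ : Val} {m₂ : Mem} (h : readSem name ge cp vargs m t vres m')
    (h' : readSem name ge cp vargs m t' vres₂ m₂) :
    MatchTraces syscalls ge t t' ∧ (t = t' → vres = vres₂ ∧ m' = m₂) := by
  have h₀ := h
  have h₀' := h'
  obtain ⟨fd, b, ofs, count, id, stored, r, rfl, rfl, rfl, -, hs, -, -, hst, -⟩ :=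
    readSem_iff.1 h
  obtain ⟨fd', b', ofs', count', id', stored', r', hv, rfl, rfl, -, hs', -, -, hst', -⟩ :=
    readSem_iff.1 h'
  simp only [List.cons.injEq, Val.Vint.injEq, Val.Vptr.injEq, and_true] at hv
  obtain ⟨rfl, ⟨rfl, rfl⟩, hcount⟩ := hv
  obtain rfl := Vptrofs_injective hcount
  obtain rfl := ge.findSymbol_injective _ _ _ hs hs'
  rw [← hname] at h₀ h₀'
  refine ⟨.syscall _ _ _ _ _ _ _ (EVptrofs_valid _ _) (EVptrofs_valid _ _)
    (by rw [EVptrofs_type, EVptrofs_type]) ⟨_, _, _, _, _, _, h₀⟩ ⟨_, _, _, _, _, _, h₀'⟩, ?_⟩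
  intro heq
  simp only [List.cons.injEq, Event.syscall.injEq, true_and, and_true] at heq
  obtain ⟨hr, rfl⟩ := heq
  rw [hst] at hst'
  exact ⟨by rw [EVptrofs_injective hr], Option.some.inj hst'⟩

theorem readSem_extcallProperties {syscalls : String → ExtcallSem}
    (hname : syscalls name = readSem name) :
    ExtcallProperties syscalls (readSem name) ioSig where
  well_typed ge cp vargs m₁ t vres m₂ h := by
    obtain ⟨_, _, _, _, _, _, r, -, -, rfl, -⟩ := readSem_iff.1 h
    exact Vptrofs_hasType r
  symbols_preserved ge₁ ge₂ cp vargs m₁ t vres m₂ heq h := by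
    obtain ⟨fd, b, ofs, count, id, stored, r, h1, h2, h3, h4, h5, h6⟩ := readSem_iff.1 h
    exact readSem_iff.2 ⟨fd, b, ofs, count, id, stored, r, h1, h2, h3,
      (heq.publicSymbol id).trans h4, (heq.findSymbol id).trans h5, h6⟩
  valid_block ge cp vargs m₁ t vres m₂ b h hb := by
    obtain ⟨_, _, _, h⟩ := exists_storebytes_of_readSem h
    rwa [Mem.validBlock_storebytes h]
  can_access ge cp vargs m₁ t vres m₂ b cp' h hb := by
    obtain ⟨_, _, _, h⟩ := exists_storebytes_of_readSem h
    rwa [Mem.canAccess_storebytes h]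
  max_perm ge cp vargs m₁ t vres m₂ b ofs p h _ hp := by
    obtain ⟨_, _, _, h⟩ := exists_storebytes_of_readSem h
    rwa [Mem.perm_storebytes h] at hp
  readonly ge cp vargs m₁ t vres m₂ b ofs n cp' bytes h _ hl hw := by
    obtain ⟨_, _, _, h⟩ := exists_storebytes_of_readSem h
    exact Mem.loadbytes_of_readonly h hl hw
  outside_compartment ge cp vargs m₁ t vres m₂ h := by
    obtain ⟨_, _, _, h⟩ := exists_storebytes_of_readSem h
    exact Mem.storebytes_unchangedOn h
      fun _ _ _ hn => hn (Mem.storebytes_eq_some_iff.1 h).2.1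
  mem_extends ge cp vargs m₁ t vres m₂ m₁' vargs' h hext hargs := by
    obtain ⟨fd, b, ofs, count, id, stored, r, rfl, h2, rfl, h4, h5, hw, hlen, hst, htr⟩ :=
      readSem_iff.1 h
    obtain rfl := forall₂_lessdef_io hargs
    have hid : injectId b = some (b, 0) := rfl
    have hw' := hext.inj.rangePerm hid hw
    obtain ⟨m₂', hst'⟩ := hext.inj.exists_storebytes hid hst
    rw [add_zero] at hst'
    rw [add_zero, add_zero] at hw'
    refine ⟨Vptrofs r, m₂', readSem_iff.2 ⟨fd, b, ofs, count, id, stored, r, rfl, h2, rfl, h4, h5,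
      hw', hlen, hst', htr⟩, .refl _,
      hext.storebytes (Mem.inject_of_mem_map_byte _ _) hst hst',
      Mem.storebytes_unchangedOn hst' ?_⟩
    intro o ho1 ho2 hn
    exact hn ((Mem.storebytes_eq_some_iff.1 hst).1 o ho1 ho2).max_nonempty
  mem_inject ge₁ ge₂ cp vargs m₁ t vres m₂ f m₁' vargs' hsym h hinj hargs := by
    obtain ⟨fd, b, ofs, count, id, stored, r, rfl, h2, rfl, h4, h5, hw, hlen, hst, htr⟩ :=
      readSem_iff.1 h
    obtain ⟨b', hf, h5', rfl⟩ := forall₂_inject_io_symbol hsym h5 hargs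
    have hw' := hinj.inj.rangePerm hf hw
    obtain ⟨m₂', hst'⟩ := hinj.inj.exists_storebytes hf hst
    have hinj' := hinj.storebytes hf (Mem.inject_of_mem_map_byte _ _) hst hst'
    rw [add_zero] at hst'
    rw [add_zero, add_zero] at hw'
    refine ⟨f, Vptrofs r, m₂', readSem_iff.2 ⟨fd, b', ofs, count, id, stored, r, rfl, h2, rfl,
      (hsym.publicSymbol id).trans h4, h5', hw', hlen, hst', htr⟩, Vptrofs_inject f r, hinj',
      Mem.storebytes_unchangedOn hst ?_, Mem.storebytes_unchangedOn hst' ?_,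
      fun _ _ _ h => h, fun _ _ _ h1 h2 => by simp [h1] at h2⟩
    · intro o _ _ hn
      rw [LocUnmapped, hf] at hn
      cases hn
    · intro o ho1 ho2 hn
      refine hn b 0 hf ?_
      rw [sub_zero]
      exact ((Mem.storebytes_eq_some_iff.1 hst).1 o ho1 ho2).max_nonempty
  trace_length ge cp vargs m t vres m' h := by
    obtain ⟨_, _, _, _, _, _, _, -, rfl, -⟩ := readSem_iff.1 h
    exact le_rfl
  no_crossing ge cp vargs m t vres m' e h he := by
    obtain ⟨_, _, _, _, _, _, _, -, rfl, -⟩ := readSem_iff.1 h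
    obtain rfl := List.mem_singleton.1 he
    exact ⟨fun _ _ _ _ => nofun, fun _ _ _ => nofun⟩
  receptive _ _ _ _ _ _ _ _ h ht := readSem_receptive hname h ht
  determ _ _ _ _ _ _ _ _ _ _ h h' := readSem_determ hname h h'

end Read

/-! ### The model of `write` -/

section Write

variable [Archi] {name : String} {ge : Senv} {cp : Compartment} {vargs : List Val} {m m' : Mem}
  {t : Trace} {vres : Val}

theorem writeSem_iff : writeSem name ge cp vargs m t vres m' ↔
    m' = m ∧ ∃ fd b ofs count id loaded k r,
      vargs = [.Vint fd, .Vptr b ofs, Vptrofs count] ∧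
      t = [.syscall name [.EVint fd, .EVptrGlobal id ofs, EVptrofs count] loaded (EVptrofs r) []] ∧
      vres = Vptrofs r ∧ ge.publicSymbol id = true ∧ ge.findSymbol id = some b ∧
      m.loadbytes b ofs.toNat count.toNat cp = some (loaded.map .Byte) ∧
      k ≤ count.toNat ∧ TransferResult k (Vptrofs r) := by
  constructor
  · rintro ⟨_, _, fd, b, ofs, count, _, args, res, loaded, k, _, h1, h2, h3, h4, h5⟩
    obtain ⟨r, rfl⟩ := h4.exists_eq_Vptrofs
    obtain rfl := eventvalMatch_Vptrofs_iff.1 h5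
    obtain ⟨id, hp, hs, rfl⟩ := eventvalListMatch_io_iff.1 h1
    exact ⟨rfl, fd, b, ofs, count, id, loaded, k, r, rfl, rfl, rfl, hp, hs, h2, h3, h4⟩
  · rintro ⟨rfl, fd, b, ofs, count, id, loaded, k, r, rfl, rfl, rfl, hp, hs, h2, h3, h4⟩
    exact .intro ge cp fd b ofs count _ _ _ loaded k _
      (eventvalListMatch_io_iff.2 ⟨id, hp, hs, rfl⟩) h2 h3 h4 (eventvalMatch_Vptrofs_iff.2 rfl)

theorem writeSem_receptive {syscalls : String → ExtcallSem} (hname : syscalls name = writeSem name)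
    {t' : Trace} (h : writeSem name ge cp vargs m t vres m') (ht : MatchTraces syscalls ge t t') :
    ∃ vres₂ m₂, writeSem name ge cp vargs m t' vres₂ m₂ := by
  obtain ⟨rfl, fd, b, ofs, count, id, loaded, k, r, rfl, rfl, rfl, hp, hs, hl, -, -⟩ :=
    writeSem_iff.1 h
  cases ht with
  | syscall _ _ _ _ _ res₂ stored₂ _ _ _ _ hprod =>
    obtain ⟨ge', cp', vargs', m₀, v', m₀', hsem⟩ := hprod
    rw [hname] at hsem
    obtain ⟨-, fd', b', ofs', count', id', loaded', k', r', -, heq, -, -, -, -, hk, htr⟩ :=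
      writeSem_iff.1 hsem
    simp only [List.cons.injEq, Event.syscall.injEq, true_and, and_true] at heq
    obtain ⟨⟨-, -, hcount⟩, -, rfl, rfl⟩ := heq
    obtain rfl := EVptrofs_injective hcount
    exact ⟨Vptrofs r', m', writeSem_iff.2 ⟨rfl, fd, b, ofs, count, id, loaded, k', r', rfl, rfl,
      rfl, hp, hs, hl, hk, htr⟩⟩

theorem writeSem_determ {syscalls : String → ExtcallSem} (hname : syscalls name = writeSem name)
    {t' : Trace} {vres₂ : Val} {m₂ : Mem} (h : writeSem name ge cp vargs m t vres m')
    (h' : writeSem name ge cp vargs m t' vres₂ m₂) :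
    MatchTraces syscalls ge t t' ∧ (t = t' → vres = vres₂ ∧ m' = m₂) := by
  have h₀ := h
  have h₀' := h'
  obtain ⟨rfl, fd, b, ofs, count, id, loaded, k, r, rfl, rfl, rfl, -, hs, hl, -, -⟩ :=
    writeSem_iff.1 h
  obtain ⟨rfl, fd', b', ofs', count', id', loaded', k', r', hv, rfl, rfl, -, hs', hl', -, -⟩ :=
    writeSem_iff.1 h'
  simp only [List.cons.injEq, Val.Vint.injEq, Val.Vptr.injEq, and_true] at hv
  obtain ⟨rfl, ⟨rfl, rfl⟩, hcount⟩ := hv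
  obtain rfl := Vptrofs_injective hcount
  obtain rfl := ge.findSymbol_injective _ _ _ hs hs'
  rw [hl, Option.some.injEq] at hl'
  obtain rfl := List.map_injective_iff.2 (fun _ _ => Memval.Byte.inj) hl'
  rw [← hname] at h₀ h₀'
  refine ⟨.syscall _ _ _ _ _ _ _ (EVptrofs_valid _ _) (EVptrofs_valid _ _)
    (by rw [EVptrofs_type, EVptrofs_type]) ⟨_, _, _, _, _, _, h₀⟩ ⟨_, _, _, _, _, _, h₀'⟩, ?_⟩
  intro heq
  simp only [List.cons.injEq, Event.syscall.injEq, true_and, and_true] at heq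
  exact ⟨by rw [EVptrofs_injective heq], rfl⟩

theorem writeSem_extcallProperties {syscalls : String → ExtcallSem}
    (hname : syscalls name = writeSem name) :
    ExtcallProperties syscalls (writeSem name) ioSig where
  well_typed ge cp vargs m₁ t vres m₂ h := by
    obtain ⟨-, _, _, _, _, _, _, _, r, -, -, rfl, -⟩ := writeSem_iff.1 h
    exact Vptrofs_hasType r
  symbols_preserved ge₁ ge₂ cp vargs m₁ t vres m₂ heq h := by
    obtain ⟨h0, fd, b, ofs, count, id, loaded, k, r, h1, h2, h3, h4, h5, h6⟩ := writeSem_iff.1 h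
    exact writeSem_iff.2 ⟨h0, fd, b, ofs, count, id, loaded, k, r, h1, h2, h3,
      (heq.publicSymbol id).trans h4, (heq.findSymbol id).trans h5, h6⟩
  valid_block ge cp vargs m₁ t vres m₂ b h hb := by
    rwa [(writeSem_iff.1 h).1]
  can_access ge cp vargs m₁ t vres m₂ b cp' h hb := by
    rwa [(writeSem_iff.1 h).1]
  max_perm ge cp vargs m₁ t vres m₂ b ofs p h _ hp := by
    rwa [(writeSem_iff.1 h).1] at hp
  readonly ge cp vargs m₁ t vres m₂ b ofs n cp' bytes h _ hl _ := by
    rwa [(writeSem_iff.1 h).1] at hl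
  outside_compartment ge cp vargs m₁ t vres m₂ h := by
    rw [(writeSem_iff.1 h).1]
    exact .refl _ _
  mem_extends ge cp vargs m₁ t vres m₂ m₁' vargs' h hext hargs := by
    obtain ⟨rfl, fd, b, ofs, count, id, loaded, k, r, rfl, h2, rfl, h4, h5, hl, hk, htr⟩ :=
      writeSem_iff.1 h
    obtain rfl := forall₂_lessdef_io hargs
    have hl' := hext.inj.loadbytes (rfl : injectId b = some (b, 0)) hl
    rw [add_zero] at hl'
    exact ⟨Vptrofs r, m₁', writeSem_iff.2 ⟨rfl, fd, b, ofs, count, id, loaded, k, r, rfl, h2, rfl,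
      h4, h5, hl', hk, htr⟩, .refl _, hext, .refl _ _⟩
  mem_inject ge₁ ge₂ cp vargs m₁ t vres m₂ f m₁' vargs' hsym h hinj hargs := by
    obtain ⟨rfl, fd, b, ofs, count, id, loaded, k, r, rfl, h2, rfl, h4, h5, hl, hk, htr⟩ :=
      writeSem_iff.1 h
    obtain ⟨b', hf, h5', rfl⟩ := forall₂_inject_io_symbol hsym h5 hargs
    have hl' := hinj.inj.loadbytes hf hl
    rw [add_zero] at hl'
    exact ⟨f, Vptrofs r, m₁', writeSem_iff.2 ⟨rfl, fd, b', ofs, count, id, loaded, k, r, rfl, h2,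
      rfl, (hsym.publicSymbol id).trans h4, h5', hl', hk, htr⟩, Vptrofs_inject f r, hinj,
      .refl _ _, .refl _ _, fun _ _ _ h => h, fun _ _ _ h1 h2 => by simp [h1] at h2⟩
  trace_length ge cp vargs m t vres m' h := by
    obtain ⟨-, _, _, _, _, _, _, _, _, -, rfl, -⟩ := writeSem_iff.1 h
    exact le_rfl
  no_crossing ge cp vargs m t vres m' e h he := by
    obtain ⟨-, _, _, _, _, _, _, _, _, -, rfl, -⟩ := writeSem_iff.1 h
    obtain rfl := List.mem_singleton.1 he
    exact ⟨fun _ _ _ _ => nofun, fun _ _ _ => nofun⟩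
  receptive _ _ _ _ _ _ _ _ h ht := writeSem_receptive hname h ht
  determ _ _ _ _ _ _ _ _ _ _ h h' := writeSem_determ hname h h'

end Write

end Secomp

theorem mainTheorem8 [Secomp.Archi] (syscalls : String → Secomp.ExtcallSem) :
    (∀ name : String, syscalls name = Secomp.readSem name →
      Secomp.ExtcallProperties syscalls (syscalls name) Secomp.ioSig) ∧
    (∀ name : String, syscalls name = Secomp.writeSem name →
      Secomp.ExtcallProperties syscalls (syscalls name) Secomp.ioSig) := by
  constructor
  · intro name h
    rw [h]
    exact Secomp.readSem_extcallProperties h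
  · intro name h
    rw [h]
    exact Secomp.writeSem_extcallProperties h
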